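/- Let $\Lambda\subset\mathbb C$ be a lattice (the $\mathbb Z$-span of two $\mathbb R$-linearly independent periods) and let $$\sigma(z)=z\prod_{s\in\Lambda\setminus\{0\}}\Bigl(1-\frac zs\Bigr)\exp\Bigl(\frac zs+\frac{z^2}{2s^2}\Bigr)$$ be its Weierstrass sigma function. Let $\alpha,\beta,\gamma,w\in\mathbb C$ be such that $\alpha+kw\notin\Lambda$ for every $k\in\mathbb Z$ and $\beta\notin\Lambda$, and define the moments $$c_n=c_n(\alpha,\beta,\gamma,w)=e^{\gamma wn+\gamma\alpha}\,\frac{\sigma(wn+\beta+\alpha)}{\sigma(wn+\alpha)\,\sigma(\beta)},\qquad n\in\mathbb Z,$$ and the Toeplitz determinants $\Delta_n=\Delta_n(\alpha,\beta,\gamma,w)=\det(c_{j-i})_{0\le i,j\le n-1}$, $\Delta_0=1$. Assume $\Delta_n(\alpha,\beta,\gamma,w)\neq0$ for all $n\ge1$. The monic Laurent biorthogonal polynomials with these moments are $$P_n(z;\alpha,\beta,\gamma,w)=\frac1{\Delta_n}\begin{vmatrix}c_0&c_1&\cdots&c_n\\ c_{-1}&c_0&\cdots&c_{n-1}\\ \vdots&\vdots&&\vdots\\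 c_{1-n}&c_{2-n}&\cdots&c_1\\ 1&z&\cdots&z^n\end{vmatrix},\qquad n\ge 0 .$$ Let $\mathcal D$ be the linear operator on polynomials in $z$ given by $\mathcal D z^n=\mu_nz^{n-1}$ for $n\ge 0$, with $\mu_n=\dfrac{\sigma(wn)}{\sigma(wn+\alpha)}$ (so $\mu_0=0$ and $\mathcal D1=0$). Then for every integer $m\ge0$ the polynomials with $\beta$ replaced by $\beta+m\alpha$ are well defined, that is, $\beta+m\alpha\notin\Lambda$ and $\Delta_n(\alpha,\beta+m\alpha,\gamma,w)\ne0$ for all $n\ge0$. For every $n\ge1$, $$\mathcal D P_n(z;\alpha,\beta,\gamma,w)=\mu_n\,P_{n-1}(z;\alpha,\beta+\alpha,\gamma,w),$$ and for all $0\le m\le n$, $$\mathcal D^mP_n(z;\alpha,\beta,\gamma,w)=\mu_n\mu_{n-1}\cdots\mu_{n-m+1}\,P_{n-m}(z;\alpha,\beta+m\alpha,\gamma,w).$$ -/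

import Mathlib

noncomputable section

namespace EllipticLBP

/-- The Weierstrass sigma function of the period lattice of `L`:
`σ(z) = z ∏_{s ≠ 0} (1 - z / s) exp (z / s + z² / (2 s²))`, with `s` running over the nonzero
lattice points. The product converges absolutely for every `z`. -/
def sigma (L : PeriodPair) (z : ℂ) : ℂ :=
  z * ∏' s : {s : ℂ // s ∈ L.lattice ∧ s ≠ 0},
    (1 - z / s.1) * Complex.exp (z / s.1 + z ^ 2 / (2 * s.1 ^ 2))

/-- The moments `c_n = e^{γ w n + γ α} σ(w n + β + α) / (σ(w n + α) σ(β))`, for integer `n`. -/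
def moment (L : PeriodPair) (α β γ w : ℂ) (n : ℤ) : ℂ :=
  Complex.exp (γ * w * n + γ * α) *
    (sigma L (w * n + β + α) / (sigma L (w * n + α) * sigma L β))

/-- The Toeplitz determinant `Δ_n = det (c_{j - i})_{0 ≤ i, j < n}` of a moment sequence. -/
def toeplitzDet (c : ℤ → ℂ) (n : ℕ) : ℂ :=
  (Matrix.of fun i j : Fin n => c ((j : ℤ) - (i : ℤ))).det

/-- The monic Laurent biorthogonal polynomial of degree `n` of a moment sequence: `Δ_n⁻¹` times the
determinant of size `n + 1` whose rows `i < n` are `(c_{j - i})_{0 ≤ j ≤ n}` and whose last row is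
`1, z, …, z^n`. -/
def laurentBiorthogonal (c : ℤ → ℂ) (n : ℕ) : Polynomial ℂ :=
  Polynomial.C (toeplitzDet c n)⁻¹ *
    (Matrix.of fun i j : Fin (n + 1) =>
      if (i : ℕ) < n then Polynomial.C (c ((j : ℤ) - (i : ℤ)))
      else (Polynomial.X : Polynomial ℂ) ^ (j : ℕ)).det

/-- The elliptic Laurent biorthogonal polynomials `P_n(z; α, β, γ, w)`. -/
def ellipticLBP (L : PeriodPair) (α β γ w : ℂ) (n : ℕ) : Polynomial ℂ :=
  laurentBiorthogonal (moment L α β γ w) n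

/-- The generalized derivative of a sequence `μ` with `μ_0 = 0`: the linear operator on polynomials
with `z^n ↦ μ_n z^{n-1}`. -/
def genDeriv (μ : ℕ → ℂ) : Polynomial ℂ →ₗ[ℂ] Polynomial ℂ :=
  Polynomial.lsum fun n => μ n • Polynomial.monomial (n - 1)

/-- The sequence `μ_n = σ(w n) / σ(w n + α)`. -/
def ellipticMu (L : PeriodPair) (α w : ℂ) (n : ℕ) : ℂ :=
  sigma L (w * n) / sigma L (w * n + α)

theorem genDeriv_X_pow (μ : ℕ → ℂ) (n : ℕ) :
    genDeriv μ (Polynomial.X ^ n) = μ n • (Polynomial.X : Polynomial ℂ) ^ (n - 1) := by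
  rw [← Polynomial.monomial_one_right_eq_X_pow, ← Polynomial.monomial_one_right_eq_X_pow]
  simp [genDeriv, Polynomial.lsum_apply]

theorem ellipticMu_zero (L : PeriodPair) (α w : ℂ) : ellipticMu L α w 0 = 0 := by
  simp [ellipticMu, sigma]

end EllipticLBP

end

/-! Write `c` for the moments with parameter β and `c'` for those with β + α. Weierstrass's
three-term sigma identity gives `moment_relation`: a multiple of `c_k`, with coefficient depending
only on `i`, plus `σ(wi - α) c_{k-i}`, equals `σ(wi) μ_k c'_{k-i}`. At `k = 0` the right side
vanishes, as `μ_0 = 0`. So adding multiples of row 0 to the other Toeplitz rows clears column 0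
below the corner, and what remains is the Toeplitz matrix of `c'`, one size smaller, with scaled
rows and columns. This is done twice, with the same multipliers: on `Δ_{n+1}`, and on the
determinant for `P_{n+1}` after `𝒟` has acted on its last row, which then reads `0, μ_1, μ_2 z, …`.
Comparing the two results gives the derivative formula. The first also carries nonvanishing of all
determinants from β to β + α; iteration does the rest. The three-term identity comes from
Liouville's theorem. Its left side divided by `σ(a + b) σ(a - b)` is, for generic `b`, an entire
elliptic function of `a` with a zero at `a = c`. Periodicity is read off the product itself, without
quasi-periods. -/

namespace EllipticLBP

open Filter Topology

/-! ### Primary factors -/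

/-- The primary factor `(1 - z / s) exp (z / s + z² / (2 s²))`; it is `1` for `s = 0`. -/
noncomputable def primaryFactor (s z : ℂ) : ℂ :=
  (1 - z / s) * Complex.exp (z / s + z ^ 2 / (2 * s ^ 2))

theorem primaryFactor_zero_left (z : ℂ) : primaryFactor 0 z = 1 := by
  simp [primaryFactor]

theorem primaryFactor_neg (s z : ℂ) : primaryFactor (-s) (-z) = primaryFactor s z := by
  simp [primaryFactor]

theorem primaryFactor_ne_zero {s z : ℂ} (h : z ≠ s) : primaryFactor s z ≠ 0 := by
  rcases eq_or_ne s 0 with rfl | hs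
  · simp [primaryFactor]
  · refine mul_ne_zero ?_ (Complex.exp_ne_zero _)
    rw [sub_ne_zero, ne_comm, Ne, div_eq_one_iff_eq hs]
    exact h

theorem differentiable_primaryFactor (s : ℂ) : Differentiable ℂ (primaryFactor s) := by
  unfold primaryFactor
  simp only [div_eq_mul_inv]
  fun_prop

theorem norm_one_sub_mul_exp_sub_one_le {x : ℂ} (hx : ‖x‖ ≤ 1 / 2) :
    ‖(1 - x) * Complex.exp (x + x ^ 2 / 2) - 1‖ ≤ 2 * ‖x‖ ^ 3 := by
  set y := x + x ^ 2 / 2 with hy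
  have h0 := norm_nonneg x
  have hy1 : ‖y‖ ≤ 5 / 4 * ‖x‖ := by
    calc ‖y‖ ≤ ‖x‖ + ‖x ^ 2 / 2‖ := norm_add_le _ _
      _ = ‖x‖ + ‖x‖ ^ 2 / 2 := by simp
      _ ≤ _ := by nlinarith
  have hr := Complex.exp_bound (x := y) (by linarith) (n := 3) (by norm_num)
  set r := Complex.exp y - ∑ m ∈ Finset.range 3, y ^ m / m.factorial with hrdef
  have hr1 : ‖r‖ ≤ 1 / 2 * ‖x‖ ^ 3 := by
    calc ‖r‖ ≤ ‖y‖ ^ 3 * (2 / 9) := by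
          refine hr.trans_eq ?_
          norm_num [Nat.factorial]
      _ ≤ (5 / 4 * ‖x‖) ^ 3 * (2 / 9) := by gcongr
      _ ≤ _ := by nlinarith [pow_nonneg h0 3]
  have hexp : Complex.exp y = 1 + y + y ^ 2 / 2 + r := by
    rw [hrdef]
    simp [Finset.sum_range_succ, Nat.factorial]
  -- The quadratic Taylor polynomial in `y` leaves no terms of order 1 or 2 in `x`; this
  -- cancellation gives the cubic bound.
  have key : (1 - x) * Complex.exp y - 1 =
      (1 - x) * r - x ^ 3 * (1 / 2 + 3 / 8 * x + x ^ 2 / 8) := by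
    rw [hexp, hy]; ring
  have h1 : ‖1 - x‖ ≤ 3 / 2 := by
    refine (norm_sub_le _ _).trans ?_
    simp only [norm_one]; linarith
  have h2 : ‖1 / 2 + 3 / 8 * x + x ^ 2 / 8‖ ≤ 1 := by
    refine (norm_add₃_le).trans ?_
    simp only [norm_div, norm_mul, norm_pow, norm_one, Complex.norm_ofNat]
    nlinarith
  rw [key]
  calc _ ≤ ‖1 - x‖ * ‖r‖ + ‖x‖ ^ 3 * ‖1 / 2 + 3 / 8 * x + x ^ 2 / 8‖ := by
        refine (norm_sub_le _ _).trans_eq ?_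
        simp only [norm_mul, norm_pow]
    _ ≤ 3 / 2 * (1 / 2 * ‖x‖ ^ 3) + ‖x‖ ^ 3 * 1 := by gcongr
    _ ≤ _ := by nlinarith [pow_nonneg h0 3]

theorem norm_primaryFactor_sub_one_le {r : ℝ} (hr : 0 < r) {s z : ℂ} (hz : ‖z‖ ≤ r)
    (hs : 2 * r ≤ ‖s‖) : ‖primaryFactor s z - 1‖ ≤ 2 * r ^ 3 * ‖s‖ ^ (-3 : ℝ) := by
  have hs0 : 0 < ‖s‖ := by linarith
  have hx : ‖z / s‖ ≤ r / ‖s‖ := by rw [norm_div]; gcongr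
  have hx' : r / ‖s‖ ≤ 1 / 2 := by rw [div_le_iff₀ hs0]; linarith
  have e : primaryFactor s z = (1 - z / s) * Complex.exp (z / s + (z / s) ^ 2 / 2) := by
    rw [primaryFactor, div_pow, div_div, mul_comm 2 (s ^ 2)]
  rw [e]
  refine (norm_one_sub_mul_exp_sub_one_le (hx.trans hx')).trans ?_
  calc 2 * ‖z / s‖ ^ 3 ≤ 2 * (r / ‖s‖) ^ 3 := by gcongr
    _ = 2 * r ^ 3 * ‖s‖ ^ (-3 : ℝ) := by
      rw [Real.rpow_neg hs0.le, div_pow]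
      norm_cast
      ring

/-! ### The sigma function: convergence, simple zeros, oddness -/

variable (L : PeriodPair)

open scoped Classical in
/-- The factor of the sigma product at the lattice point `s`, with the one at `l` omitted. -/
noncomputable def sigmaFactor (l : ℂ) (s : L.lattice) (z : ℂ) : ℂ :=
  if (s : ℂ) = l then 1 else primaryFactor s z

theorem differentiable_sigmaFactor (l : ℂ) (s : L.lattice) :
    Differentiable ℂ (sigmaFactor L l s) := by
  unfold sigmaFactor
  split_ifs
  · exact differentiable_const _
  · exact differentiable_primaryFactor _

theorem summable_norm_rpow_lattice : Summable fun s : L.lattice => ‖(s : ℂ)‖ ^ (-3 : ℝ) :=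
  ZLattice.summable_norm_rpow _ _ (by simp; norm_num)

theorem eventually_norm_sigmaFactor_sub_one_le (l : ℂ) {r : ℝ} (hr : 0 < r) :
    ∀ᶠ s : L.lattice in cofinite, ∀ z ∈ Metric.ball (0 : ℂ) r,
      ‖sigmaFactor L l s z - 1‖ ≤ 2 * r ^ 3 * ‖(s : ℂ)‖ ^ (-3 : ℝ) := by
  refine (isCompact_iff_finite.mp (isCompact_closedBall (0 : L.lattice) (2 * r))).subset ?_
  intro s hs
  contrapose! hs
  simp only [Metric.mem_closedBall, dist_zero_right, not_le] at hs
  simp only [Set.mem_compl_iff, Set.mem_ofPred_eq, not_not]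
  intro z hz
  unfold sigmaFactor
  split_ifs
  · simp only [sub_self, norm_zero]; positivity
  · exact norm_primaryFactor_sub_one_le hr (by simpa using (mem_ball_zero_iff.mp hz).le) hs.le

theorem hasProdLocallyUniformlyOn_sigmaFactor (l : ℂ) {r : ℝ} (hr : 0 < r) :
    HasProdLocallyUniformlyOn (sigmaFactor L l) (fun z => ∏' s, sigmaFactor L l s z)
      (Metric.ball (0 : ℂ) r) := by
  have := Summable.hasProdLocallyUniformlyOn_one_add Metric.isOpen_ball
    ((summable_norm_rpow_lattice L).mul_left (2 * r ^ 3))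
    (eventually_norm_sigmaFactor_sub_one_le L l hr)
    (fun s => ((differentiable_sigmaFactor L l s).continuous.sub continuous_const).continuousOn)
  simpa using this

/-- The sigma product over the nonzero lattice points, with the factor at `l` omitted. -/
noncomputable def sigmaExcept (l z : ℂ) : ℂ := ∏' s, sigmaFactor L l s z

theorem hasProd_sigmaFactor (l z : ℂ) :
    HasProd (fun s => sigmaFactor L l s z) (sigmaExcept L l z) :=
  (hasProdLocallyUniformlyOn_sigmaFactor L l (r := ‖z‖ + 1) (by positivity)).hasProd (by simp)

theorem differentiable_sigmaExcept (l : ℂ) : Differentiable ℂ (sigmaExcept L l) := by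
  intro z
  have h := hasProdLocallyUniformlyOn_sigmaFactor L l (r := ‖z‖ + 1) (by positivity)
  have : DifferentiableOn ℂ (sigmaExcept L l) (Metric.ball 0 (‖z‖ + 1)) :=
    TendstoLocallyUniformlyOn.differentiableOn h
      (.of_forall fun t => (DifferentiableOn.fun_finsetProd fun s _ =>
        (differentiable_sigmaFactor L l s).differentiableOn)) Metric.isOpen_ball
  exact this.differentiableAt (Metric.isOpen_ball.mem_nhds (by simp))

/-- An absolutely convergent product vanishes only if a factor does. The alternative `s = 0` is
harmless because that factor is `1`. -/
theorem sigmaExcept_ne_zero {l z : ℂ} (h : ∀ s ∈ L.lattice, s ≠ l → z ≠ s ∨ s = 0) :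
    sigmaExcept L l z ≠ 0 := by
  have e : sigmaExcept L l z = ∏' s, (1 + (sigmaFactor L l s z - 1)) := by
    simp [sigmaExcept]
  rw [e]
  refine tprod_one_add_ne_zero_of_summable (fun s => ?_) ?_
  · rw [add_sub_cancel]
    unfold sigmaFactor
    split_ifs with hs
    · exact one_ne_zero
    · rcases h s s.2 hs with h | h
      · exact primaryFactor_ne_zero h
      · rw [h, primaryFactor_zero_left]; exact one_ne_zero
  · refine Summable.of_norm_bounded_eventually
      ((summable_norm_rpow_lattice L).mul_left (2 * (‖z‖ + 1) ^ 3)) ?_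
    filter_upwards [eventually_norm_sigmaFactor_sub_one_le L l (r := ‖z‖ + 1) (by positivity)]
      with s hs
    simpa using hs z (by simp)

theorem sigma_eq_mul_sigmaExcept_zero (z : ℂ) : sigma L z = z * sigmaExcept L 0 z := by
  unfold sigma
  congr 1
  let g : {s : ℂ // s ∈ L.lattice ∧ s ≠ 0} → L.lattice := fun s => ⟨s.1, s.2.1⟩
  have hg : Function.Injective g := fun a b h => Subtype.ext (congrArg (fun t : L.lattice => t.1) h)
  have := hg.tprod_eq (f := fun s => sigmaFactor L 0 s z) (by
    intro s hs
    by_cases h0 : (s : ℂ) = 0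
    · simp [sigmaFactor, h0, primaryFactor_zero_left] at hs
    · exact ⟨⟨s, s.2, h0⟩, rfl⟩)
  rw [sigmaExcept, ← this]
  refine tprod_congr fun s => ?_
  simp [sigmaFactor, g, s.2.2, primaryFactor]

theorem hasProd_primaryFactor (z : ℂ) :
    HasProd (fun s : L.lattice => primaryFactor s z) (sigmaExcept L 0 z) := by
  convert hasProd_sigmaFactor L 0 z using 2 with s
  unfold sigmaFactor
  split_ifs with h
  · rw [h, primaryFactor_zero_left]
  · rfl

theorem sigmaExcept_zero_eq_mul (l : L.lattice) (z : ℂ) :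
    sigmaExcept L 0 z = primaryFactor l z * sigmaExcept L l z := by
  classical
  have h := (hasProd_ite_eq (α := ℂ) l (primaryFactor l z)).mul (hasProd_sigmaFactor L l z)
  refine (hasProd_primaryFactor L z).unique ?_
  convert h using 2 with s
  by_cases hs : s = l
  · subst hs; simp [sigmaFactor]
  · simp [sigmaFactor, hs]

theorem differentiable_sigma : Differentiable ℂ (sigma L) := by
  have : sigma L = fun z => z * sigmaExcept L 0 z := funext (sigma_eq_mul_sigmaExcept_zero L)
  rw [this]
  exact differentiable_id.mul (differentiable_sigmaExcept L 0)

theorem continuous_sigma : Continuous (sigma L) := (differentiable_sigma L).continuous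

theorem sigma_eq_zero_iff {z : ℂ} : sigma L z = 0 ↔ z ∈ L.lattice := by
  constructor
  · intro h
    by_contra hz
    rw [sigma_eq_mul_sigmaExcept_zero] at h
    refine mul_ne_zero ?_ (sigmaExcept_ne_zero L ?_) h
    · rintro rfl; exact hz (zero_mem _)
    · intro s hs _
      left; rintro rfl; exact hz hs
  · intro h
    rcases eq_or_ne z 0 with rfl | hz
    · simp [sigma]
    · rw [sigma_eq_mul_sigmaExcept_zero, sigmaExcept_zero_eq_mul L ⟨z, h⟩]
      simp [primaryFactor, hz]

/-- Splitting off the factor that vanishes at `l` leaves a cofactor that is nonzero there, so the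
zero is simple. -/
theorem deriv_sigma_ne_zero {l : ℂ} (hl : l ∈ L.lattice) : deriv (sigma L) l ≠ 0 := by
  rcases eq_or_ne l 0 with rfl | hl0
  · have hd := ((hasDerivAt_id (0 : ℂ)).mul (differentiable_sigmaExcept L 0 0).hasDerivAt)
    have : sigma L = id * sigmaExcept L 0 := funext (sigma_eq_mul_sigmaExcept_zero L)
    rw [this, hd.deriv]
    simpa using sigmaExcept_ne_zero L (l := 0) (z := 0) fun s _ h => .inl h.symm
  · set g : ℂ → ℂ := fun z => -(z / l) * Complex.exp (z / l + z ^ 2 / (2 * l ^ 2)) *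
      sigmaExcept L l z with hg
    have hgd : Differentiable ℂ g := by
      have := differentiable_sigmaExcept L l
      simp only [hg, div_eq_mul_inv]
      fun_prop
    have : sigma L = (fun z => z - l) * g := by
      funext z
      rw [sigma_eq_mul_sigmaExcept_zero, sigmaExcept_zero_eq_mul L ⟨l, hl⟩]
      simp only [primaryFactor, Pi.mul_apply, hg]
      field_simp
      ring
    have hd : HasDerivAt (fun z : ℂ => z - l) 1 l := (hasDerivAt_id l).sub_const l
    rw [this, (hd.mul (hgd l).hasDerivAt).deriv]
    have hne := sigmaExcept_ne_zero L (l := l) (z := l) fun s _ h => .inl h.symm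
    simp [hg, hl0, hne]

theorem sigma_neg (z : ℂ) : sigma L (-z) = -sigma L z := by
  rw [sigma_eq_mul_sigmaExcept_zero, sigma_eq_mul_sigmaExcept_zero]
  have : sigmaExcept L 0 (-z) = sigmaExcept L 0 z := by
    rw [← (hasProd_primaryFactor L (-z)).tprod_eq, ← (hasProd_primaryFactor L z).tprod_eq,
      ← (Equiv.neg L.lattice).tprod_eq]
    simp [primaryFactor_neg]
  rw [this, neg_mul]

/-! ### Periodicity of sigma ratios -/

/-- In the exponents of the factors at `a + x` and `a - x`, the terms odd in `x` cancel, and those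
free of `x` cancel in the quotient. Only the `1 / s²` part still obstructs shifting `s`. -/
theorem hasProd_sigma_ratio {a b : ℂ} (d : ℂ) (h₁ : a + b ∉ L.lattice) (h₂ : a - b ∉ L.lattice) :
    HasProd (fun s : L.lattice => ((s - a) ^ 2 - d ^ 2) / ((s - a) ^ 2 - b ^ 2) *
        Complex.exp ((d ^ 2 - b ^ 2) * (1 / (s : ℂ) ^ 2)))
      (sigma L (a + d) * sigma L (a - d) / (sigma L (a + b) * sigma L (a - b))) := by
  classical
  have hne : ∀ z ∉ L.lattice, sigmaExcept L 0 z ≠ 0 := fun z hz =>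
    sigmaExcept_ne_zero L fun s hs _ => .inl (by rintro rfl; exact hz hs)
  -- The prefactors `z` of the four sigmas supply the factor at `s = 0`, where `1 / 0 = 0` makes the
  -- exponential trivial.
  have H := (hasProd_ite_eq (α := ℂ) (0 : L.lattice) ((a ^ 2 - d ^ 2) / (a ^ 2 - b ^ 2))).mul
    (((hasProd_primaryFactor L (a + d)).mul (hasProd_primaryFactor L (a - d))).div₀
      ((hasProd_primaryFactor L (a + b)).mul (hasProd_primaryFactor L (a - b)))
      (mul_ne_zero (hne _ h₁) (hne _ h₂)))
  convert H using 1
  · funext s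
    by_cases hs : s = 0
    · subst hs
      simp [primaryFactor_zero_left]
    · have hs' : (s : ℂ) ≠ 0 := by simpa using hs
      have hn₁ : (s : ℂ) - (a + b) ≠ 0 := fun h => h₁ (by rw [← sub_eq_zero.mp h]; exact s.2)
      have hn₂ : (s : ℂ) - (a - b) ≠ 0 := fun h => h₂ (by rw [← sub_eq_zero.mp h]; exact s.2)
      have hn : ((s : ℂ) - a) ^ 2 - b ^ 2 ≠ 0 := by
        rw [show ((s : ℂ) - a) ^ 2 - b ^ 2 = (s - (a + b)) * (s - (a - b)) by ring]
        exact mul_ne_zero hn₁ hn₂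
      have hexp : ∀ x : ℂ, Complex.exp ((a + x) / s + (a + x) ^ 2 / (2 * s ^ 2)) *
          Complex.exp ((a - x) / s + (a - x) ^ 2 / (2 * s ^ 2)) =
          Complex.exp (2 * a / s + a ^ 2 / s ^ 2) * Complex.exp (x ^ 2 * (1 / (s : ℂ) ^ 2)) := by
        intro x
        rw [← Complex.exp_add, ← Complex.exp_add]
        congr 1
        field_simp
        ring
      have hlin : ∀ x : ℂ, (1 - (a + x) / s) * (1 - (a - x) / s) =
          (((s : ℂ) - a) ^ 2 - x ^ 2) / s ^ 2 := by
        intro x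
        field_simp
        ring
      have hpf : ∀ x : ℂ, primaryFactor s (a + x) * primaryFactor s (a - x) =
          (((s : ℂ) - a) ^ 2 - x ^ 2) / s ^ 2 * (Complex.exp (2 * a / s + a ^ 2 / s ^ 2) *
            Complex.exp (x ^ 2 * (1 / (s : ℂ) ^ 2))) := by
        intro x
        rw [← hlin, ← hexp]
        unfold primaryFactor
        ring
      rw [if_neg hs, one_mul, hpf, hpf, sub_mul (d ^ 2), Complex.exp_sub]
      have e₁ := Complex.exp_ne_zero (2 * a / s + a ^ 2 / s ^ 2)
      have e₂ := Complex.exp_ne_zero (b ^ 2 * (1 / (s : ℂ) ^ 2))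
      field_simp
  · simp only [sigma_eq_mul_sigmaExcept_zero]
    rw [div_mul_div_comm]
    congr 1 <;> ring

/-- With `1 / 0 = 0`, the substitution `s ↦ -l - s` changes the sign of the exponent, so the
exponents sum to `0`. Here the sum is obtained as the value `0` assigned to `℘` at lattice points.
-/
theorem hasProd_exp_lattice_shift (l : L.lattice) (c : ℂ) :
    HasProd (fun s : L.lattice =>
      Complex.exp (c * (1 / ((s + l : L.lattice) : ℂ) ^ 2 - 1 / (s : ℂ) ^ 2))) 1 := by
  have h := (L.hasSum_weierstrassP ((-l : L.lattice) : ℂ)).mul_left c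
  rw [L.weierstrassP_coe, mul_zero] at h
  have h' := h.exp
  rw [← Complex.exp_eq_exp_ℂ, Complex.exp_zero] at h'
  convert h' using 2 with s
  simp only [Function.comp_apply, Submodule.coe_add, NegMemClass.coe_neg]
  congr 4
  ring

theorem sigma_ratio_periodic {l : ℂ} (hl : l ∈ L.lattice) (a b d : ℂ) :
    sigma L (a + l + d) * sigma L (a + l - d) * (sigma L (a + b) * sigma L (a - b)) =
      sigma L (a + d) * sigma L (a - d) * (sigma L (a + l + b) * sigma L (a + l - b)) := by
  have hshift : ∀ z, z + l ∈ L.lattice ↔ z ∈ L.lattice := fun z =>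
    L.lattice.toAddSubgroup.add_mem_cancel_right hl
  by_cases h₁ : a + b ∈ L.lattice
  · have h₁' : a + l + b ∈ L.lattice := by rw [add_right_comm]; exact (hshift _).mpr h₁
    rw [(sigma_eq_zero_iff L).mpr h₁, (sigma_eq_zero_iff L).mpr h₁']
    simp
  by_cases h₂ : a - b ∈ L.lattice
  · have h₂' : a + l - b ∈ L.lattice := by rw [add_sub_right_comm]; exact (hshift _).mpr h₂
    rw [(sigma_eq_zero_iff L).mpr h₂, (sigma_eq_zero_iff L).mpr h₂']
    simp
  have h₁' : a + l + b ∉ L.lattice := by rwa [add_right_comm, hshift]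
  have h₂' : a + l - b ∉ L.lattice := by rwa [add_sub_right_comm, hshift]
  have H := (hasProd_sigma_ratio L d h₁ h₂).mul
    (hasProd_exp_lattice_shift L ⟨l, hl⟩ (d ^ 2 - b ^ 2))
  have H' := (Equiv.addRight (⟨l, hl⟩ : L.lattice)).hasProd_iff.mpr
    (hasProd_sigma_ratio L d h₁' h₂')
  have e := H.unique (by
    convert H' using 2 with s
    simp only [Function.comp_apply, Equiv.coe_addRight, Submodule.coe_add]
    rw [mul_sub, Complex.exp_sub, add_sub_add_right_eq_sub]
    have := Complex.exp_ne_zero ((d ^ 2 - b ^ 2) * (1 / (s : ℂ) ^ 2))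
    field_simp)
  have n₁ := mt (sigma_eq_zero_iff L).mp h₁
  have n₂ := mt (sigma_eq_zero_iff L).mp h₂
  have n₁' := mt (sigma_eq_zero_iff L).mp h₁'
  have n₂' := mt (sigma_eq_zero_iff L).mp h₂'
  rw [mul_one, div_eq_div_iff (mul_ne_zero n₁ n₂) (mul_ne_zero n₁' n₂')] at e
  exact e.symm

/-! ### Liouville's theorem and the three-term identity -/

/-- If an entire function vanishes at the zeros of another one, and these are all simple, then
the quotient is entire. -/
theorem exists_differentiable_eq_mul {f g : ℂ → ℂ} (hf : Differentiable ℂ f)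
    (hg : Differentiable ℂ g) (h : ∀ z, g z = 0 → f z = 0 ∧ deriv g z ≠ 0) :
    ∃ q : ℂ → ℂ, Differentiable ℂ q ∧ ∀ z, f z = q z * g z := by
  classical
  refine ⟨fun z => if g z = 0 then deriv f z / deriv g z else f z / g z, fun z => ?_, fun z => ?_⟩
  · by_cases hz : g z = 0
    · obtain ⟨hfz, hgz⟩ := h z hz
      -- Near a common zero the quotient equals the quotient of the divided differences, which are
      -- entire.
      have key : ∀ {u : ℂ → ℂ}, Differentiable ℂ u → Differentiable ℂ (dslope u z) := fun hu =>
        differentiableOn_univ.mp <| (Complex.differentiableOn_dslope univ_mem).mpr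
          hu.differentiableOn
      have hne : dslope g z z ≠ 0 := by rwa [dslope_same]
      refine (((key hf) z).div ((key hg) z) hne).congr_of_eventuallyEq ?_
      filter_upwards [(key hg).continuous.continuousAt.eventually_ne hne] with x hx
      rcases eq_or_ne x z with rfl | hxz
      · simp [hz]
      · have hgx : g x ≠ 0 := by
          intro h0
          rw [dslope_of_ne _ hxz, slope_def_field, h0, hz] at hx
          simp at hx
        rw [if_neg hgx, Pi.div_apply, dslope_of_ne _ hxz, dslope_of_ne _ hxz, slope_def_field,
          slope_def_field, hfz, hz, sub_zero, sub_zero,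
          div_div_div_cancel_right₀ (sub_ne_zero.mpr hxz)]
    · refine ((hf z).div (hg z) hz).congr_of_eventuallyEq ?_
      filter_upwards [hg.continuous.continuousAt.eventually_ne hz] with x hx
      rw [if_neg hx, Pi.div_apply]
  · by_cases hz : g z = 0
    · rw [(h z hz).1, hz, mul_zero]
    · simp only [if_neg hz]
      rw [div_mul_cancel₀ _ hz]

theorem countable_lattice : (L.lattice : Set ℂ).Countable := by
  have : Countable L.lattice := L.latticeEquivProd.toEquiv.countable_iff.mpr inferInstance
  exact this

/-- An entire function with the periods of a lattice, off a countable set, is constant. -/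
theorem eq_of_differentiable_of_periodic {q : ℂ → ℂ} (hq : Differentiable ℂ q)
    {s : Set ℂ} (hs : s.Countable)
    (hper : ∀ z ∉ s, ∀ l ∈ L.lattice, q (z + l) = q z) (z w : ℂ) : q z = q w := by
  have hper' : ∀ z l, l ∈ L.lattice → q (z + l) = q z := by
    intro z l hl
    have hd : Dense sᶜ := hs.dense_compl ℝ
    have : (fun z => q (z + l)) = q :=
      Continuous.ext_on hd (hq.continuous.comp (continuous_add_const l)) hq.continuous
        fun z hz => hper z hz l hl
    exact congrFun this z
  exact hq.apply_eq_apply_of_bounded (IsZLattice.isCompact_range_of_periodic L.lattice _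
    hq.continuous hper').isBounded z w

theorem sigma_three_term_of_generic {b c : ℂ} (hb : 2 * b ∉ L.lattice) (hc₁ : c + b ∉ L.lattice)
    (hc₂ : c - b ∉ L.lattice) (a d : ℂ) :
    sigma L (b + c) * sigma L (b - c) * (sigma L (a + d) * sigma L (a - d)) -
      sigma L (b + d) * sigma L (b - d) * (sigma L (a + c) * sigma L (a - c)) +
      sigma L (c + d) * sigma L (c - d) * (sigma L (a + b) * sigma L (a - b)) = 0 := by
  set N : ℂ → ℂ := fun a =>
    sigma L (b + c) * sigma L (b - c) * (sigma L (a + d) * sigma L (a - d)) -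
      sigma L (b + d) * sigma L (b - d) * (sigma L (a + c) * sigma L (a - c)) +
      sigma L (c + d) * sigma L (c - d) * (sigma L (a + b) * sigma L (a - b)) with hN
  set D : ℂ → ℂ := fun a => sigma L (a + b) * sigma L (a - b) with hD
  have hσ := differentiable_sigma L
  have hNd : Differentiable ℂ N := by fun_prop
  have hDd : Differentiable ℂ D := by fun_prop
  have hb0 : b ∉ L.lattice := fun h => hb (by rw [two_mul]; exact add_mem h h)
  have hσb : sigma L b ≠ 0 := mt (sigma_eq_zero_iff L).mp hb0
  -- Every term of `N` has the same multiplier under `a ↦ a + l`, written without division. Taking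
  -- `e = 0` moves the zeros `±b` of `N` to all their translates.
  have hNper : ∀ l ∈ L.lattice, ∀ a e, N (a + l) * (sigma L (a + e) * sigma L (a - e)) =
      N a * (sigma L (a + l + e) * sigma L (a + l - e)) := by
    intro l hl a e
    simp only [hN]
    linear_combination sigma L (b + c) * sigma L (b - c) * sigma_ratio_periodic L hl a e d -
      sigma L (b + d) * sigma L (b - d) * sigma_ratio_periodic L hl a e c +
      sigma L (c + d) * sigma L (c - d) * sigma_ratio_periodic L hl a e b
  have hNb : N b = 0 := by
    simp only [hN, sub_self, (sigma_eq_zero_iff L).mpr (zero_mem L.lattice)]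
    ring
  have hNb' : N (-b) = 0 := by
    have e : ∀ x, sigma L (-b + x) * sigma L (-b - x) = sigma L (b + x) * sigma L (b - x) := by
      intro x
      rw [show -b + x = -(b - x) by ring, show -b - x = -(b + x) by ring, sigma_neg, sigma_neg]
      ring
    simp only [hN, e, sub_self, (sigma_eq_zero_iff L).mpr (zero_mem L.lattice)]
    ring
  have hzero : ∀ z, D z = 0 → N z = 0 ∧ deriv D z ≠ 0 := by
    intro z hz
    have hderiv : deriv D z =
        deriv (sigma L) (z + b) * sigma L (z - b) + sigma L (z + b) * deriv (sigma L) (z - b) :=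
      (((hσ (z + b)).hasDerivAt.comp_add_const z b).mul
        ((hσ (z - b)).hasDerivAt.comp_sub_const z b)).deriv
    rcases mul_eq_zero.mp hz with h | h
    · have hm := (sigma_eq_zero_iff L).mp h
      have hne : sigma L (z - b) ≠ 0 := fun h' => hb (by
        have := sub_mem hm ((sigma_eq_zero_iff L).mp h')
        rwa [show z + b - (z - b) = 2 * b by ring] at this)
      refine ⟨?_, ?_⟩
      · have := hNper _ hm (-b) 0
        rw [hNb', zero_mul, show -b + (z + b) = z by ring, add_zero, sub_zero, sigma_neg] at this
        exact (mul_eq_zero.mp this).resolve_right (by simpa using hσb)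
      · rw [hderiv, h, zero_mul, add_zero]
        exact mul_ne_zero (deriv_sigma_ne_zero L hm) hne
    · have hm := (sigma_eq_zero_iff L).mp h
      have hne : sigma L (z + b) ≠ 0 := fun h' => hb (by
        have := sub_mem ((sigma_eq_zero_iff L).mp h') hm
        rwa [show z + b - (z - b) = 2 * b by ring] at this)
      refine ⟨?_, ?_⟩
      · have := hNper _ hm b 0
        rw [hNb, zero_mul, show b + (z - b) = z by ring, add_zero, sub_zero] at this
        exact (mul_eq_zero.mp this).resolve_right (by simpa using hσb)
      · rw [hderiv, h, mul_zero, zero_add]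
        exact mul_ne_zero hne (deriv_sigma_ne_zero L hm)
  obtain ⟨q, hqd, hq⟩ := exists_differentiable_eq_mul hNd hDd hzero
  have hcount : {z | D z = 0}.Countable := by
    refine (((countable_lattice L).preimage_of_injOn (f := fun z => z + b)
      (add_left_injective b).injOn).union ((countable_lattice L).preimage_of_injOn
      (f := fun z => z - b) (sub_left_injective).injOn)).mono fun z hz => ?_
    exact (mul_eq_zero.mp hz).imp (sigma_eq_zero_iff L).mp (sigma_eq_zero_iff L).mp
  have hqper : ∀ z ∉ {z | D z = 0}, ∀ l ∈ L.lattice, q (z + l) = q z := by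
    intro z hz l hl
    have hz' : D (z + l) ≠ 0 := by
      intro h
      refine hz ((mul_eq_zero.mp h).elim (fun h => ?_) (fun h => ?_))
      · refine mul_eq_zero_of_left ((sigma_eq_zero_iff L).mpr ?_) _
        have := sub_mem ((sigma_eq_zero_iff L).mp h) hl
        rwa [show z + l + b - l = z + b by ring] at this
      · refine mul_eq_zero_of_right _ ((sigma_eq_zero_iff L).mpr ?_)
        have := sub_mem ((sigma_eq_zero_iff L).mp h) hl
        rwa [show z + l - b - l = z - b by ring] at this
    have := hNper l hl z b
    rw [hq, hq z] at this
    change q (z + l) * D (z + l) * D z = q z * D z * D (z + l) at this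
    exact mul_right_cancel₀ (mul_ne_zero hz' hz) (by linear_combination this)
  have hqc : q c = 0 := by
    have hNc : N c = 0 := by
      simp only [hN, sub_self, (sigma_eq_zero_iff L).mpr (zero_mem L.lattice)]
      rw [show b - c = -(c - b) by ring, show b + c = c + b by ring, sigma_neg,
        show b + d = d + b by ring]
      ring
    have := hq c
    rw [hNc] at this
    exact (mul_eq_zero.mp this.symm).resolve_right (mul_ne_zero
      (mt (sigma_eq_zero_iff L).mp hc₁) (mt (sigma_eq_zero_iff L).mp hc₂))
  have := hq a
  rw [eq_of_differentiable_of_periodic L hqd hcount hqper a c, hqc, zero_mul] at this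
  exact this

/-- The excluded values of `b` are countable, so continuity in `b` removes the genericity. -/
theorem sigma_three_term (a b c d : ℂ) :
    sigma L (b + c) * sigma L (b - c) * (sigma L (a + d) * sigma L (a - d)) -
      sigma L (b + d) * sigma L (b - d) * (sigma L (a + c) * sigma L (a - c)) +
      sigma L (c + d) * sigma L (c - d) * (sigma L (a + b) * sigma L (a - b)) = 0 := by
  have hΛ := countable_lattice L
  set S : Set ℂ := ((fun b => 2 * b) ⁻¹' L.lattice ∪ (fun b => c + b) ⁻¹' L.lattice) ∪
    (fun b => c - b) ⁻¹' L.lattice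
  have hS : S.Countable :=
    ((hΛ.preimage_of_injOn (mul_right_injective₀ two_ne_zero).injOn).union
      (hΛ.preimage_of_injOn (add_right_injective c).injOn)).union
      (hΛ.preimage_of_injOn sub_right_injective.injOn)
  have hσ := continuous_sigma L
  have := Continuous.ext_on (hS.dense_compl ℝ) (f := fun b =>
    sigma L (b + c) * sigma L (b - c) * (sigma L (a + d) * sigma L (a - d)) -
      sigma L (b + d) * sigma L (b - d) * (sigma L (a + c) * sigma L (a - c)) +
      sigma L (c + d) * sigma L (c - d) * (sigma L (a + b) * sigma L (a - b)))
    (g := fun _ => 0) (by fun_prop) continuous_const fun b hb =>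
      sigma_three_term_of_generic L (fun h => hb (.inl (.inl h))) (fun h => hb (.inl (.inr h)))
        (fun h => hb (.inr h)) a d
  exact congrFun this b

/-! ### Determinants -/

/-- Clearing the first column of a determinant by row operations with the row `0`. -/
theorem det_eq_of_row_relations {R : Type*} [CommRing R] {n : ℕ}
    (M : Matrix (Fin (n + 1)) (Fin (n + 1)) R) (M' : Matrix (Fin n) (Fin n) R)
    (A B κ μ : Fin n → R) (h₀ : ∀ i, A i * M 0 0 + B i * M i.succ 0 = 0)
    (h : ∀ i j : Fin n,
      A i * M 0 j.succ + B i * M i.succ j.succ = κ i * (μ j * M' i j)) :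
    (∏ i, B i) * M.det = M 0 0 * ((∏ i, κ i) * ((∏ i, μ i) * M'.det)) := by
  set B' : Fin (n + 1) → R := Fin.cons 1 B with hB'
  set A' : Fin (n + 1) → R := Fin.cons 0 A with hA'
  set T : Matrix (Fin (n + 1)) (Fin (n + 1)) R :=
    Matrix.of fun i j => B' i * M i j + A' i * M 0 j with hT
  have e₁ : (∏ i, B i) * M.det = T.det := by
    have : ∏ i, B i = ∏ i, B' i := by simp [hB', Fin.prod_univ_succ]
    rw [this, ← Matrix.det_mul_column]
    refine (Matrix.det_eq_of_forall_row_eq_smul_add_const A' 0 (by simp [hA']) fun i j => ?_).symm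
    simp [hT, hB']
  have e₂ : T.submatrix (Fin.succAbove 0) Fin.succ =
      Matrix.of fun i j => κ i * (Matrix.of fun i j => μ j * M' i j) i j := by
    ext i j
    simp only [hT, hB', hA', Matrix.submatrix_apply, Matrix.of_apply, Fin.zero_succAbove,
      Fin.cons_succ]
    rw [add_comm, h]
  have e₃ : ∀ i : Fin n, T i.succ 0 = 0 := fun i => by
    simp only [hT, hB', hA', Matrix.of_apply, Fin.cons_succ]
    rw [add_comm, h₀]
  rw [e₁, Matrix.det_succ_column_zero, Fin.sum_univ_succ, e₂, Matrix.det_mul_column,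
    Matrix.det_mul_row]
  simp only [e₃, mul_zero, zero_mul, Finset.sum_const_zero, add_zero]
  simp [hT, hB', hA']

/-- The bordered Toeplitz matrix with last row `r`. -/
noncomputable def borderedToeplitz (c : ℤ → ℂ) (r : ℕ → Polynomial ℂ) (n : ℕ) :
    Matrix (Fin (n + 1)) (Fin (n + 1)) (Polynomial ℂ) :=
  Matrix.of fun i j => if (i : ℕ) < n then Polynomial.C (c ((j : ℤ) - (i : ℤ))) else r j

/-- The cofactors of the last row are scalars independent of that row, so a linear operator can be
applied to the row entrywise. -/
theorem det_borderedToeplitz (c : ℤ → ℂ) (n : ℕ) :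
    ∃ m : Fin (n + 1) → ℂ, ∀ r : ℕ → Polynomial ℂ,
      (borderedToeplitz c r n).det = ∑ j, m j • r j := by
  refine ⟨fun j => (-1) ^ (n + j : ℕ) *
    (Matrix.of fun i k : Fin n => c (((j.succAbove k : Fin (n + 1)) : ℤ) - (i : ℤ))).det,
    fun r => ?_⟩
  rw [Matrix.det_succ_row _ (Fin.last n)]
  refine Finset.sum_congr rfl fun j _ => ?_
  have e : (borderedToeplitz c r n).submatrix (Fin.last n).succAbove j.succAbove =
      (Polynomial.C : ℂ →+* Polynomial ℂ).mapMatrix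
        (Matrix.of fun i k : Fin n => c (((j.succAbove k : Fin (n + 1)) : ℤ) - (i : ℤ))) := by
    ext1 i k
    simp [borderedToeplitz]
  rw [e, ← RingHom.map_det, Polynomial.smul_eq_C_mul]
  simp only [borderedToeplitz, Matrix.of_apply, Fin.val_last, lt_irrefl, if_false, map_mul, map_pow,
    map_neg, map_one]
  ring

theorem genDeriv_det_borderedToeplitz (μ : ℕ → ℂ) (c : ℤ → ℂ) (n : ℕ) :
    genDeriv μ (borderedToeplitz c (fun j => Polynomial.X ^ j) n).det =
      (borderedToeplitz c (fun j => μ j • Polynomial.X ^ (j - 1)) n).det := by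
  obtain ⟨m, hm⟩ := det_borderedToeplitz c n
  rw [hm, hm, map_sum]
  exact Finset.sum_congr rfl fun j _ => by rw [map_smul, genDeriv_X_pow]

theorem laurentBiorthogonal_eq (c : ℤ → ℂ) (n : ℕ) :
    laurentBiorthogonal c n = Polynomial.C (toeplitzDet c n)⁻¹ *
      (borderedToeplitz c (fun j => Polynomial.X ^ j) n).det := rfl

/-! ### Elliptic moments and the change from β to β + α -/

variable {α β γ w : ℂ}

theorem moment_relation (hα : ∀ k : ℤ, α + k * w ∉ L.lattice) (hβ : β ∉ L.lattice)
    (hβα : β + α ∉ L.lattice) (i k : ℤ) :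
    Complex.exp (-(γ * (w * i))) * sigma L α * sigma L (α + β - w * i) / sigma L (β + α) *
        moment L α β γ w k + sigma L (w * i - α) * moment L α β γ w (k - i) =
      sigma L (w * i) * (sigma L (w * k) / sigma L (w * k + α) *
        moment L α (β + α) γ w (k - i)) := by
  have n₁ : sigma L β ≠ 0 := mt (sigma_eq_zero_iff L).mp hβ
  have n₂ : sigma L (β + α) ≠ 0 := mt (sigma_eq_zero_iff L).mp hβα
  have n₃ : sigma L (w * k + α) ≠ 0 := mt (sigma_eq_zero_iff L).mp (by
    rw [add_comm, mul_comm]; exact hα k)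
  have n₄ : sigma L (w * (k - i) + α) ≠ 0 := mt (sigma_eq_zero_iff L).mp (by
    have := hα (k - i)
    rwa [show α + ((k - i : ℤ) : ℂ) * w = w * (k - i) + α by push_cast; ring] at this)
  have hexp : Complex.exp (γ * w * k + γ * α) =
      Complex.exp (γ * (w * i)) * Complex.exp (γ * w * (k - i) + γ * α) := by
    rw [← Complex.exp_add]; congr 1; ring
  -- The half-sums are chosen so that the pairwise sums and differences are, up to sign, the sigma
  -- arguments left after clearing denominators.
  have T := sigma_three_term L (w * k - w * i / 2 + β / 2 + α) ((β - w * i) / 2 + α)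
    ((w * i + β) / 2) ((w * i - β) / 2)
  rw [show (β - w * i) / 2 + α + (w * i + β) / 2 = β + α by ring,
    show (β - w * i) / 2 + α - (w * i + β) / 2 = -(w * i - α) by ring,
    show w * k - w * i / 2 + β / 2 + α + (w * i - β) / 2 = w * k + α by ring,
    show w * k - w * i / 2 + β / 2 + α - (w * i - β) / 2 = w * (k - i) + β + α by ring,
    show (β - w * i) / 2 + α + (w * i - β) / 2 = α by ring,
    show (β - w * i) / 2 + α - (w * i - β) / 2 = α + β - w * i by ring,
    show w * k - w * i / 2 + β / 2 + α + (w * i + β) / 2 = w * k + β + α by ring,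
    show w * k - w * i / 2 + β / 2 + α - (w * i + β) / 2 = w * (k - i) + α by ring,
    show (w * i + β) / 2 + (w * i - β) / 2 = w * i by ring,
    show (w * i + β) / 2 - (w * i - β) / 2 = β by ring,
    show w * k - w * i / 2 + β / 2 + α + ((β - w * i) / 2 + α) =
      w * (k - i) + (β + α) + α by ring,
    show w * k - w * i / 2 + β / 2 + α - ((β - w * i) / 2 + α) = w * k by ring, sigma_neg] at T
  unfold moment
  push_cast
  rw [hexp, Complex.exp_neg]
  have n₅ := Complex.exp_ne_zero (γ * (w * i))
  generalize Complex.exp (γ * w * (k - i) + γ * α) = E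
  field_simp
  linear_combination (-E) * T

theorem sigma_mul_sub_ne_zero (hα : ∀ k : ℤ, α + k * w ∉ L.lattice) (i : ℤ) :
    sigma L (w * i - α) ≠ 0 := mt (sigma_eq_zero_iff L).mp fun h => by
  have := L.lattice.neg_mem h
  refine hα (-i) ?_
  rwa [show -(w * (i : ℂ) - α) = α + ((-i : ℤ) : ℂ) * w by push_cast; ring] at this

theorem toeplitzDet_moment_succ (hα : ∀ k : ℤ, α + k * w ∉ L.lattice) (hβ : β ∉ L.lattice)
    (hβα : β + α ∉ L.lattice) (n : ℕ) :
    (∏ i : Fin n, sigma L (w * ((i + 1 : ℕ) : ℤ) - α)) * toeplitzDet (moment L α β γ w) (n + 1) =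
      moment L α β γ w 0 * ((∏ i : Fin n, sigma L (w * ((i + 1 : ℕ) : ℤ))) *
        ((∏ j : Fin n, ellipticMu L α w (j + 1)) *
          toeplitzDet (moment L α (β + α) γ w) n)) := by
  have H := det_eq_of_row_relations
    (Matrix.of fun i j : Fin (n + 1) => moment L α β γ w ((j : ℤ) - (i : ℤ)))
    (Matrix.of fun i j : Fin n => moment L α (β + α) γ w ((j : ℤ) - (i : ℤ)))
    (fun i => Complex.exp (-(γ * (w * ((i + 1 : ℕ) : ℤ)))) * sigma L α *
      sigma L (α + β - w * ((i + 1 : ℕ) : ℤ)) / sigma L (β + α))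
    (fun i => sigma L (w * ((i + 1 : ℕ) : ℤ) - α)) (fun i => sigma L (w * ((i + 1 : ℕ) : ℤ)))
    (fun j => ellipticMu L α w (j + 1)) ?_ ?_
  · simpa [toeplitzDet] using H
  · intro i
    have := moment_relation L (γ := γ) hα hβ hβα ((i + 1 : ℕ) : ℤ) 0
    rw [Int.cast_zero, mul_zero, (sigma_eq_zero_iff L).mpr (zero_mem L.lattice), zero_div, zero_mul,
      mul_zero] at this
    simpa using this
  · intro i j
    have := moment_relation L (γ := γ) hα hβ hβα ((i + 1 : ℕ) : ℤ) ((j + 1 : ℕ) : ℤ)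
    simpa [ellipticMu] using this

theorem det_borderedToeplitz_moment_succ (hα : ∀ k : ℤ, α + k * w ∉ L.lattice)
    (hβ : β ∉ L.lattice) (hβα : β + α ∉ L.lattice) (n : ℕ) :
    Polynomial.C (∏ i : Fin n, sigma L (w * ((i + 1 : ℕ) : ℤ) - α)) *
        (borderedToeplitz (moment L α β γ w)
          (fun j => ellipticMu L α w j • Polynomial.X ^ (j - 1)) (n + 1)).det =
      Polynomial.C (moment L α β γ w 0 * ((∏ i : Fin n, sigma L (w * ((i + 1 : ℕ) : ℤ))) *
        ∏ j : Fin (n + 1), ellipticMu L α w (j + 1))) *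
        (borderedToeplitz (moment L α (β + α) γ w) (fun j => Polynomial.X ^ j) n).det := by
  have H := det_eq_of_row_relations
    (borderedToeplitz (moment L α β γ w)
      (fun j => ellipticMu L α w j • Polynomial.X ^ (j - 1)) (n + 1))
    (borderedToeplitz (moment L α (β + α) γ w) (fun j => Polynomial.X ^ j) n)
    -- The last row is left alone (`A = 0`, `B = κ = 1`): its first entry is already `0` and its
    -- others already carry `μ`.
    (Fin.snoc (fun i : Fin n => Polynomial.C
      (Complex.exp (-(γ * (w * ((i + 1 : ℕ) : ℤ)))) * sigma L α *
        sigma L (α + β - w * ((i + 1 : ℕ) : ℤ)) / sigma L (β + α))) 0)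
    (Fin.snoc (fun i : Fin n => Polynomial.C (sigma L (w * ((i + 1 : ℕ) : ℤ) - α))) 1)
    (Fin.snoc (fun i : Fin n => Polynomial.C (sigma L (w * ((i + 1 : ℕ) : ℤ)))) 1)
    (fun j => Polynomial.C (ellipticMu L α w (j + 1))) ?_ ?_
  · rw [Fin.prod_univ_castSucc, Fin.prod_univ_castSucc (n := n)] at H
    simp only [Fin.snoc_castSucc, Fin.snoc_last, mul_one, ← map_prod] at H
    rw [H]
    simp only [borderedToeplitz, map_mul]
    simp
    ring
  · intro i
    refine Fin.lastCases ?_ (fun i => ?_) i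
    · simp [borderedToeplitz, ellipticMu_zero]
    · have := moment_relation L (γ := γ) hα hβ hβα ((i + 1 : ℕ) : ℤ) 0
      rw [Int.cast_zero, mul_zero, (sigma_eq_zero_iff L).mpr (zero_mem L.lattice), zero_div,
        zero_mul, mul_zero] at this
      have := congrArg Polynomial.C this
      simpa [borderedToeplitz] using this
  · intro i j
    refine Fin.lastCases ?_ (fun i => ?_) i
    · simp [borderedToeplitz, Polynomial.smul_eq_C_mul]
    · have := moment_relation L (γ := γ) hα hβ hβα ((i + 1 : ℕ) : ℤ) ((j + 1 : ℕ) : ℤ)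
      have := congrArg Polynomial.C this
      simpa [borderedToeplitz, ellipticMu] using this

/-- `Δ_1 = c_0` contains the factor `σ(β + α)`. -/
theorem add_notMem_lattice_of_toeplitzDet_one_ne_zero
    (h : toeplitzDet (moment L α β γ w) 1 ≠ 0) : β + α ∉ L.lattice := by
  intro hm
  refine h ?_
  simp [toeplitzDet, moment, (sigma_eq_zero_iff L).mpr hm]

theorem toeplitzDet_moment_add_ne_zero (hα : ∀ k : ℤ, α + k * w ∉ L.lattice) (hβ : β ∉ L.lattice)
    (hΔ : ∀ n : ℕ, toeplitzDet (moment L α β γ w) n ≠ 0) (n : ℕ) :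
    toeplitzDet (moment L α (β + α) γ w) n ≠ 0 := by
  intro h
  have := toeplitzDet_moment_succ L (γ := γ) hα hβ
    (add_notMem_lattice_of_toeplitzDet_one_ne_zero L (hΔ 1)) n
  rw [h, mul_zero, mul_zero, mul_zero] at this
  exact mul_ne_zero (Finset.prod_ne_zero_iff.mpr fun i _ => sigma_mul_sub_ne_zero L hα _)
    (hΔ (n + 1)) this

theorem genDeriv_ellipticLBP_succ (hα : ∀ k : ℤ, α + k * w ∉ L.lattice) (hβ : β ∉ L.lattice)
    (hΔ : ∀ n : ℕ, toeplitzDet (moment L α β γ w) n ≠ 0) (n : ℕ) :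
    genDeriv (ellipticMu L α w) (ellipticLBP L α β γ w (n + 1)) =
      ellipticMu L α w (n + 1) • ellipticLBP L α (β + α) γ w n := by
  have hβα := add_notMem_lattice_of_toeplitzDet_one_ne_zero L (hΔ 1)
  have hB : ∏ i : Fin n, sigma L (w * ((i + 1 : ℕ) : ℤ) - α) ≠ 0 :=
    Finset.prod_ne_zero_iff.mpr fun i _ => sigma_mul_sub_ne_zero L hα _
  have h₁ := toeplitzDet_moment_succ L (γ := γ) hα hβ hβα n
  have h₂ := det_borderedToeplitz_moment_succ L (γ := γ) hα hβ hβα n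
  have hΔ' := toeplitzDet_moment_add_ne_zero L hα hβ hΔ n
  rw [ellipticLBP, ellipticLBP, laurentBiorthogonal_eq, laurentBiorthogonal_eq,
    ← Polynomial.smul_eq_C_mul, ← Polynomial.smul_eq_C_mul, map_smul,
    genDeriv_det_borderedToeplitz]
  rw [← Polynomial.smul_eq_C_mul, ← Polynomial.smul_eq_C_mul, Fin.prod_univ_castSucc] at h₂
  simp only [Fin.val_castSucc, Fin.val_last] at h₂
  generalize (borderedToeplitz (moment L α β γ w)
    (fun j => ellipticMu L α w j • Polynomial.X ^ (j - 1)) (n + 1)).det = p at h₂ ⊢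
  generalize (borderedToeplitz (moment L α (β + α) γ w) (fun j => Polynomial.X ^ j) n).det = q
    at h₂ ⊢
  rw [smul_smul, inv_smul_eq_iff₀ (hΔ (n + 1)), smul_smul]
  -- Multiplying by the common row factor lets both determinant identities be used without division
  -- by it.
  refine smul_right_injective _ hB ?_
  change _ • p = _ • (_ • q)
  rw [h₂, smul_smul]
  congr 1
  field_simp
  linear_combination (-ellipticMu L α w (n + 1)) * h₁

end EllipticLBP

theorem mainTheorem5 (L : PeriodPair) (α β γ w : ℂ)
    (hα : ∀ k : ℤ, α + k * w ∉ L.lattice)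
    (hβ : β ∉ L.lattice)
    (hΔ : ∀ n : ℕ, 1 ≤ n → EllipticLBP.toeplitzDet (EllipticLBP.moment L α β γ w) n ≠ 0) :
    (∀ m : ℕ, β + m * α ∉ L.lattice ∧
      ∀ n : ℕ, EllipticLBP.toeplitzDet (EllipticLBP.moment L α (β + m * α) γ w) n ≠ 0) ∧
    (∀ n : ℕ, 1 ≤ n →
      EllipticLBP.genDeriv (EllipticLBP.ellipticMu L α w) (EllipticLBP.ellipticLBP L α β γ w n) =
        EllipticLBP.ellipticMu L α w n • EllipticLBP.ellipticLBP L α (β + α) γ w (n - 1)) ∧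
    (∀ n m : ℕ, m ≤ n →
      (EllipticLBP.genDeriv (EllipticLBP.ellipticMu L α w))^[m]
          (EllipticLBP.ellipticLBP L α β γ w n) =
        (∏ i ∈ Finset.range m, EllipticLBP.ellipticMu L α w (n - i)) •
          EllipticLBP.ellipticLBP L α (β + m * α) γ w (n - m)) := by
  have hΔ₀ : ∀ n : ℕ, EllipticLBP.toeplitzDet (EllipticLBP.moment L α β γ w) n ≠ 0 := by
    intro n
    rcases Nat.eq_zero_or_pos n with rfl | hn
    · simp [EllipticLBP.toeplitzDet]
    · exact hΔ n hn
  have hsucc : ∀ m : ℕ, β + ((m + 1 : ℕ) : ℂ) * α = β + m * α + α := fun m => by push_cast; ring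
  have hm : ∀ m : ℕ, β + m * α ∉ L.lattice ∧
      ∀ n : ℕ, EllipticLBP.toeplitzDet (EllipticLBP.moment L α (β + m * α) γ w) n ≠ 0 := by
    intro m
    induction m with
    | zero => simpa using ⟨hβ, hΔ₀⟩
    | succ m ih =>
      rw [hsucc]
      exact ⟨EllipticLBP.add_notMem_lattice_of_toeplitzDet_one_ne_zero L (ih.2 1),
        EllipticLBP.toeplitzDet_moment_add_ne_zero L hα ih.1 ih.2⟩
  refine ⟨hm, fun n hn => ?_, fun n m => ?_⟩
  · obtain ⟨n, rfl⟩ := Nat.exists_eq_add_of_le' hn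
    exact EllipticLBP.genDeriv_ellipticLBP_succ L hα hβ hΔ₀ n
  · induction m with
    | zero => simp
    | succ m ih =>
      intro h
      obtain ⟨k, hk⟩ : ∃ k, n - m = k + 1 := ⟨n - m - 1, by omega⟩
      rw [Function.iterate_succ_apply', ih (by omega), map_smul, hsucc, Finset.prod_range_succ,
        mul_smul, hk, EllipticLBP.genDeriv_ellipticLBP_succ L hα (hm m).1 (hm m).2,
        show n - (m + 1) = k by omega]
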